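/- **Setting.** All spaces are finite-dimensional complex Hilbert spaces, and $\mathcal D$ is a finite set of inputs. *Span programs.* A span program on $\mathcal D$ is $\mathcal P=(\mathcal H,\,x\mapsto\mathcal H(x),\,\mathcal K,\,|w_0\rangle)$ with subspaces $\mathcal H(x),\mathcal K\subseteq\mathcal H$ and $|w_0\rangle\in\mathcal K^\perp$. An input $x$ is positive if $|w_0\rangle\in\mathcal K+\mathcal H(x)$, and then $w_+(x,\mathcal P)=\min\{\|w\|^2: w\in\mathcal H(x)\cap(|w_0\rangle+\mathcal K)\}$. Otherwise $x$ is negative, and then $w_-(x,\mathcal P)=\min\{\|w\|^2: w\in\mathcal H(x)^\perp\cap\mathcal K^\perp,\ \langle w_0,w\rangle=1\}$. For a negative input we put $w_+(x,\mathcal P)=0$, and for a positive one $w_-(x,\mathcal P)=0$. $\mathcal P$ decides a predicate $f$ if $x$ is positive exactly when $f(x)$ holds. *State-reflection problems.* Such a problem consists of orthogonal vectors $\sigma_x^+,\sigma_x^-$ and reflections $O_x$ (self-adjoint, $O_x^2=I$) on a space $\mathcal H$. A feasible solution consists of vectors $w_x^\pm\in\mathcal H$ with $O_xw_x^\pm=\pm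 w_x^\pm$ and $\langle\sigma_x^s,\sigma_y^t\rangle-\langle s\sigma_x^s,t\sigma_y^t\rangle=\langle w_x^s,(I-O_x^\dagger O_y)w_y^t\rangle$ for all $x,y\in\mathcal D$ and $s,t\in\{+,-\}$. Its witness sizes are $\|w_x^\pm\|^2$. Updating a register from $\xi_x$ to $\eta_x$ is the problem with $\sigma_x^\pm=|\xi_x\rangle\mp|\eta_x\rangle$. *Quantum walk search.* Let $G=(V,E)$ be a finite connected undirected graph with at least two vertices and resistances $r_e>0$ such that $\sum_{e\in E}1/r_e=1/2$. Its random walk traverses, at $v$, the edge $e\ni v$ with probability $r_v/r_e$, where $1/r_v=\sum_{e\ni v}1/r_e$. Let $P$ be its transition matrix, $\pi$ its stationary distribution, and $\delta$ its spectral gap, the minimum of $1-\lambda$ over the eigenvalues $\lambda\ne1$ of $P$. For each $x\in\mathcal D$ let $M_x\subseteq V$ be the set of marked vertices. Let $\mathcal S$ be a finite set of database entries and let $D_{v,x}\in\mathcal S$ for $v\in V$, $x\in\mathcal D$. Assume that we are given 1. for every $v\in V$, a feasible solution for updating a blank register $\perp$ to $D_{v,x}$ (setup), with witness sizes $(\mathsf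 S_v)_x^\pm$; 2. for every $e=vw\in E$, a feasible solution for updating $(v,D_{v,x})$ to $(w,D_{w,x})$ (update), with witness sizes $(\mathsf U_e)_x^\pm$; 3. for every $v\in V$ and $D\in\mathcal S$, a span program on $\mathcal D$ for which every $x$ with $D_{v,x}=D$ is positive if and only if $v\in M_x$ (checking), with witness sizes $(\mathsf C_{v,D})_x^\pm:=w_\pm(x,\cdot)$. Each routine has its own space and its own reflections $O_x$ or subspaces $\mathcal H(x)$. Let $\mathcal D_+=\{x: M_x\neq\varnothing\}$, assumed to be non-empty, and $\mathcal D_-=\mathcal D\setminus\mathcal D_+$. Put $\mathsf S_v^+=\max_{x\in\mathcal D_+}(\mathsf S_v)_x^+$, $\mathsf U_e^+=\max_{x\in\mathcal D_+}(\mathsf U_e)_x^+$, $\mathsf C_{v,D}^+=\max_{x\in\mathcal D_+}(\mathsf C_{v,D})_x^+$, and $\varepsilon=\min_{x\in\mathcal D_+}\Pr_{v\sim\pi}[v\in M_x]$. **Statement.** There is a universal constant $c>0$ such that for every such instance there is a span program $\mathcal P$ that decides whether $M_x\ne\varnothing$, whose space is the direct sum of the spaces of all setup, update and checking routines, whose subspace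 $\mathcal H(x)$ is the direct sum of the $+1$-eigenspaces of the $O_x$ of the setup and update routines and of the subspaces for input $x$ of the checking span programs, and which satisfies $$w_+(x,\mathcal P)\le c\qquad\text{for all }x\in\mathcal D_+,$$ $$w_-(x,\mathcal P)\le c\left(\mathop{\mathbb E}_{v\sim\pi}[\mathsf S_v^+]\cdot\mathop{\mathbb E}_{v\sim\pi}[(\mathsf S_v)_x^-]+\frac1\varepsilon\left(\frac1\delta\mathop{\mathbb E}_{v\sim\pi,\;w\sim P_{v\cdot}}\left[\mathsf U_{vw}^+(\mathsf U_{vw})_x^-\right]+\mathop{\mathbb E}_{v\sim\pi}\left[\mathsf C_{v,D_{v,x}}^+(\mathsf C_{v,D_{v,x}})_x^-\right]\right)\right)\qquad\text{for all }x\in\mathcal D_-,$$ where $vw$ stands for the edge that the walk traverses in one step from $v$. -/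

import Mathlib

open scoped BigOperators

noncomputable section

/-! ### Random walks on graphs with resistances -/

/-- A finite undirected graph with vertices `V`, edges `E` (parallel edges and loops are allowed)
and positive edge resistances. Every edge carries an arbitrary orientation from `src` to `tgt`. -/
structure ResistorGraph (V E : Type*) where
  src : E → V
  tgt : E → V
  res : E → ℝ
  res_pos : ∀ e, 0 < res e

namespace ResistorGraph

variable {V E : Type*} (G : ResistorGraph V E)

/-- The edge `e` connects `v` and `w`. -/
def Joins (e : E) (v w : V) : Prop :=
  (G.src e = v ∧ G.tgt e = w) ∨ (G.src e = w ∧ G.tgt e = v)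

instance [DecidableEq V] (e : E) (v w : V) : Decidable (G.Joins e v w) := by
  unfold Joins; infer_instance

/-- Any vertex can be reached from any other one along edges. -/
def Connected : Prop :=
  ∀ v w : V, Relation.ReflTransGen (fun a b => ∃ e, G.Joins e a b) v w

variable [Fintype E] [DecidableEq V]

/-- The set `N(v)` of edges that have `v` as an endpoint. -/
def incident (v : V) : Finset E :=
  Finset.univ.filter fun e => G.src e = v ∨ G.tgt e = v

/-- `r_v = (∑_{e ∈ N(v)} 1 / r_e)⁻¹`. -/
def vertexRes (v : V) : ℝ := (∑ e ∈ G.incident v, (G.res e)⁻¹)⁻¹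

/-- The transition matrix of the random walk: at `v`, the edge `e ∈ N(v)` is traversed with
probability `r_v / r_e`. -/
def transition : Matrix V V ℝ := fun v w =>
  ∑ e ∈ Finset.univ.filter (fun e => G.Joins e v w), G.vertexRes v / G.res e

/-- The expectation of `F e`, where `v` is sampled from `μ` and `e` is the edge that the walk
traverses in one step from `v`. -/
def stepExpectation [Fintype V] (μ : V → ℝ) (F : E → ℝ) : ℝ :=
  ∑ v, μ v * ∑ e ∈ G.incident v, (G.vertexRes v / G.res e) * F e

end ResistorGraph

/-- `μ` is a stationary distribution of the Markov process with transition matrix `P`. -/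
def IsStationaryDistribution {V : Type*} [Fintype V] (P : Matrix V V ℝ) (μ : V → ℝ) : Prop :=
  μ ∈ stdSimplex ℝ V ∧ Matrix.vecMul μ P = μ

/-- The spectral gap of `P`: the smallest value of `1 - lam` over the eigenvalues `lam ≠ 1`. -/
def spectralGap {V : Type*} [Fintype V] [DecidableEq V] (P : Matrix V V ℝ) : ℝ :=
  sInf {γ : ℝ | ∃ lam : ℝ, Module.End.HasEigenvalue (Matrix.toLin' P) lam ∧ lam ≠ 1 ∧
    γ = 1 - lam}

/-! ### Span programs -/

/-- A span program `(H, x ↦ H(x), K, w₀)` on the domain `X`. -/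
structure SpanProgram (X H : Type*) [NormedAddCommGroup H] [InnerProductSpace ℂ H] where
  avail : X → Submodule ℂ H
  ker : Submodule ℂ H
  target : H
  target_mem : target ∈ kerᗮ

namespace SpanProgram

variable {X H : Type*} [NormedAddCommGroup H] [InnerProductSpace ℂ H] (P : SpanProgram X H)

/-- The input `x` is positive: `w₀ ∈ K + H(x)`. Otherwise it is negative. -/
def IsPositive (x : X) : Prop := P.target ∈ P.ker ⊔ P.avail x

/-- The span program decides the predicate `f`. -/
def Computes (f : X → Prop) : Prop := ∀ x, P.IsPositive x ↔ f x

/-- Positive witnesses: the elements of `H(x) ∩ (w₀ + K)`. -/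
def posWitnesses (x : X) : Set H := {w | w ∈ P.avail x ∧ w - P.target ∈ P.ker}

/-- Negative witnesses: the elements `w` of `H(x)ᗮ ∩ Kᗮ` with `⟨w₀, w⟩ = 1`. -/
def negWitnesses (x : X) : Set H :=
  {w | w ∈ (P.avail x)ᗮ ∧ w ∈ P.kerᗮ ∧ inner ℂ P.target w = 1}

/-- `w₊(x, P)`, the minimal squared norm of a positive witness. It is `0` for negative inputs,
which have no positive witness (`sInf ∅ = 0`). -/
def posSize (x : X) : ℝ := sInf ((fun w => ‖w‖ ^ 2) '' P.posWitnesses x)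

/-- `w₋(x, P)`, the minimal squared norm of a negative witness. It is `0` for positive inputs,
which have no negative witness. -/
def negSize (x : X) : ℝ := sInf ((fun w => ‖w‖ ^ 2) '' P.negWitnesses x)

end SpanProgram

/-! ### State-conversion and state-reflection problems -/

/-- A state-conversion problem `{(σ_x, τ_x, O_x)}`, with states in `W` and oracles on `H`. -/
structure StateConversion (X W H : Type*) [AddCommGroup H] [Module ℂ H] where
  source : X → W
  goal : X → W
  oracle : X → H →ₗ[ℂ] H

/-- Feasible solutions to the adversary bound:
`⟨σ_x, σ_y⟩ - ⟨τ_x, τ_y⟩ = ⟨w_x, (I - O_x† O_y) w_y⟩` for all `x, y`. -/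
def StateConversion.IsFeasible {X W H : Type*} [NormedAddCommGroup W] [InnerProductSpace ℂ W]
    [NormedAddCommGroup H] [InnerProductSpace ℂ H] (R : StateConversion X W H)
    (w : X → H) : Prop :=
  ∀ x y, inner ℂ (R.source x) (R.source y) - inner ℂ (R.goal x) (R.goal y) =
    inner ℂ (w x) (w y) - inner ℂ (R.oracle x (w x)) (R.oracle y (w y))

/-- A family of input oracles `O_x` that are reflections: `O_x` is self-adjoint with `O_x² = I`
(equivalently, `O_x` is unitary with `O_x² = I`). -/
structure ReflectionOracle (X H : Type*) [NormedAddCommGroup H] [InnerProductSpace ℂ H] where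
  op : X → H →ₗ[ℂ] H
  sq_eq_id : ∀ x, op x ∘ₗ op x = LinearMap.id
  symm : ∀ x, (op x).IsSymmetric

/-- The `+1`-eigenspace of the oracle on input `x`. -/
def ReflectionOracle.plusSpace {X H : Type*} [NormedAddCommGroup H] [InnerProductSpace ℂ H]
    (O : ReflectionOracle X H) (x : X) : Submodule ℂ H :=
  Module.End.eigenspace (O.op x) 1

/-- Signs `±` are encoded by `Bool`: `true` is `+` and `false` is `-`. -/
def signOf (b : Bool) : ℂ := if b then 1 else -1

/-- A state-reflection problem `{(σ_x⁺, σ_x⁻, O_x)}`. -/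
structure StateReflection (X W H : Type*) [NormedAddCommGroup W] [InnerProductSpace ℂ W]
    [NormedAddCommGroup H] [InnerProductSpace ℂ H] where
  state : Bool → X → W
  orthogonal : ∀ x, inner ℂ (state true x) (state false x) = 0
  oracle : ReflectionOracle X H

namespace StateReflection

variable {X W H : Type*} [NormedAddCommGroup W] [InnerProductSpace ℂ W]
  [NormedAddCommGroup H] [InnerProductSpace ℂ H]

/-- The state-conversion problem `{(σ_x^±, ±σ_x^±, O_x)}`, indexed by signs and inputs. -/
def toConversion (R : StateReflection X W H) : StateConversion (Bool × X) W H where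
  source p := R.state p.1 p.2
  goal p := signOf p.1 • R.state p.1 p.2
  oracle p := R.oracle.op p.2

/-- A feasible solution `{w_x^±}` with `O_x w_x^± = ± w_x^±`. -/
structure Solution (R : StateReflection X W H) where
  witness : Bool → X → H
  feasible : R.toConversion.IsFeasible fun p => witness p.1 p.2
  eigen : ∀ b x, R.oracle.op x (witness b x) = signOf b • witness b x

/-- The witness sizes `R_x^±(w) = ‖w_x^±‖²`. -/
def Solution.size {R : StateReflection X W H} (w : R.Solution) (b : Bool) (x : X) : ℝ :=
  ‖w.witness b x‖ ^ 2

end StateReflection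

/-- The problem of updating a classical register from `ξ_x` to `η_x`, written as the hyperedge
problem with net-flow `|ξ_x⟩ - |η_x⟩` and potential `|ξ_x⟩ + |η_x⟩` on the vertex set `ι`. -/
def registerUpdate {X ι H : Type*} [Fintype ι] [DecidableEq ι]
    [NormedAddCommGroup H] [InnerProductSpace ℂ H]
    (ξ η : X → ι) (O : ReflectionOracle X H) : StateReflection X (EuclideanSpace ℂ ι) H where
  state b x :=
    if b then EuclideanSpace.single (ξ x) 1 - EuclideanSpace.single (η x) 1
    else EuclideanSpace.single (ξ x) 1 + EuclideanSpace.single (η x) 1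
  orthogonal x := by
    by_cases h : ξ x = η x
    · simp [h]
    · simp [EuclideanSpace.inner_single_left, h, Ne.symm h]
  oracle := O

/-! ### Quantum walk search -/

/-- The index set of all subroutines: a setup routine for every vertex, an update routine for
every edge, and a checking routine for every vertex and every database entry. -/
abbrev Routine (V E S : Type*) : Type _ := V ⊕ E ⊕ (V × S)

/-- An instance of quantum walk search on the domain `X` with database entries `S`.
The subroutine with index `i` has its witnesses (and its input oracle) in the space `H i`. -/
structure QuantumWalkSearch (V E X S : Type*) [Fintype V] [DecidableEq V] [Fintype E]
    [Fintype S] [DecidableEq S] (H : Routine V E S → Type*)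
    [∀ i, NormedAddCommGroup (H i)] [∀ i, InnerProductSpace ℂ (H i)] where
  graph : ResistorGraph V E
  connected : graph.Connected
  total_conductance : ∑ e, (graph.res e)⁻¹ = 1 / 2
  /-- The set of marked vertices on input `x`. -/
  marked : X → Finset V
  /-- The database entry associated with the vertex `v` on input `x`. -/
  data : V → X → S
  setupOracle : ∀ v, ReflectionOracle X (H (.inl v))
  /-- The setup routine at `v` computes `data v x`, from a blank register `none`. -/
  setup : ∀ v, (registerUpdate (fun _ => (none : Option S)) (fun x => some (data v x))
    (setupOracle v)).Solution
  updateOracle : ∀ e, ReflectionOracle X (H (.inr (.inl e)))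
  /-- The update routine at `e = vw` updates `data v x` to `data w x`; its vertices are the
  pairs of a vertex of the graph and a database entry. -/
  update : ∀ e, (registerUpdate (fun x => (graph.src e, data (graph.src e) x))
    (fun x => (graph.tgt e, data (graph.tgt e) x)) (updateOracle e)).Solution
  /-- The checking routines. -/
  check : ∀ p : V × S, SpanProgram X (H (.inr (.inr p)))
  /-- The checking routine at `(v, d)` decides whether `v` is marked on all inputs `x` with
  `data v x = d`; nothing is required on other inputs. -/
  check_correct : ∀ v d x, data v x = d → ((check (v, d)).IsPositive x ↔ v ∈ marked x)

namespace QuantumWalkSearch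

variable {V E X S : Type*} [Fintype V] [DecidableEq V] [Fintype E]
  [Fintype S] [DecidableEq S] {H : Routine V E S → Type*}
  [∀ i, NormedAddCommGroup (H i)] [∀ i, InnerProductSpace ℂ (H i)]
  (Q : QuantumWalkSearch V E X S H)

/-- The predicate to be detected: on input `x` there is a marked vertex. -/
def HasMarked (x : X) : Prop := (Q.marked x).Nonempty

/-- `S_v^+`, the maximum over positive inputs of the positive witness size of the setup at `v`. -/
def setupPlus (v : V) : ℝ := ⨆ x : {x // Q.HasMarked x}, (Q.setup v).size true x

/-- `U_e^+`, the maximum over positive inputs of the positive witness size of the update at `e`. -/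
def updatePlus (e : E) : ℝ := ⨆ x : {x // Q.HasMarked x}, (Q.update e).size true x

/-- `C_{v,d}^+`, the maximum over positive inputs of the positive witness size of the checking
routine at `(v, d)`. -/
def checkPlus (v : V) (d : S) : ℝ := ⨆ x : {x // Q.HasMarked x}, (Q.check (v, d)).posSize x

/-- `ε`, the minimum over positive inputs of the probability that `v ∼ μ` is marked. -/
def markedFraction (μ : V → ℝ) : ℝ := ⨅ x : {x // Q.HasMarked x}, ∑ v ∈ Q.marked x, μ v

/-- The subspace of the witness space of a single subroutine that is available on input `x`: the
`+1`-eigenspace of its oracle, or the subspace given by the span program. -/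
def routineAvail (x : X) : ∀ i : Routine V E S, Submodule ℂ (H i)
  | .inl v => (Q.setupOracle v).plusSpace x
  | .inr (.inl e) => (Q.updateOracle e).plusSpace x
  | .inr (.inr p) => (Q.check p).avail x

/-- The available subspace on input `x` of the direct sum of all subroutines. -/
def totalAvail (x : X) : Submodule ℂ (PiLp 2 H) where
  carrier := {u | ∀ i, u i ∈ Q.routineAvail x i}
  add_mem' hu hv i := (Q.routineAvail x i).add_mem (hu i) (hv i)
  zero_mem' i := (Q.routineAvail x i).zero_mem
  smul_mem' c _ hu i := (Q.routineAvail x i).smul_mem c (hu i)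

end QuantumWalkSearch

end

/-!
The kernel of the span program may be chosen freely, and so a span program on given available
subspaces `H(x)` is nothing but a choice of witnesses: vectors `u_x ∈ H(x)` for positive `x` and
`w_y ∈ H(y)ᗮ` for negative `y` with `⟨u_x, w_y⟩ = 1` for all such pairs. The kernel is then the
orthogonal complement of all `w_y` (`SpanProgram.exists_of_witnesses`).

For the search, the witnesses come from flows and potentials. On a negative input, all vertices
have potential `1`, and `w_y` is a weighted sum of the negative witnesses of all routines. On a
positive input, a unit flow enters through the setup routines, distributed as the stationary
distribution `π`, runs through the update routines, and leaves through the checking routines of the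
marked vertices, distributed as `π` conditioned on being marked; `u_x` is the corresponding sum of
positive witnesses. A routine sees whether the database entries of its vertices agree on `x` and
`y`; with the indicator `g v` of agreement at `v`, the inner product `⟨u_x, w_y⟩` is the sum of
`π v * (1 - g v)`, of the work of the flow in the potential `g`, and of the outflow weighted by `g`.
This equals `1` by Kirchhoff's law (`QuantumWalkSearch.inner_posVec_negVec`).

The flow is the electrical one. It solves a Poisson equation for the graph Laplacian, which is
`I - P` up to the factors `1 / r_v`, and is symmetric in the `π`-weighted inner product. Hence the
spectral gap `δ` bounds its energy by `2 / (δ * π(M))` for the marked set `M`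
(`ResistorGraph.exists_flow`). Weighting each routine by a multiple of its maximal positive witness
size in the negative witness, and inversely in the positive one, makes `‖u_x‖ ^ 2` a constant and
turns `‖w_y‖ ^ 2` into the stated sum of products. For the setup routines, where the flow is
always `π`, the weight uses the mean `𝔼 S_v⁺` instead of the individual sizes.
-/

/-! ### Symmetric operators with a spectral gap -/

/-- A symmetric operator can be inverted on the orthogonal complement of its kernel, and its
smallest nonzero eigenvalue controls the quadratic form of the inverse. -/
lemma LinearMap.IsSymmetric.exists_apply_eq_of_eigenvalue_gap {F : Type*} [NormedAddCommGroup F]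
    [InnerProductSpace ℝ F] [FiniteDimensional ℝ F] {T : F →ₗ[ℝ] F} (hT : T.IsSymmetric)
    {δ : ℝ} (hδ : 0 < δ)
    (hgap : ∀ lam, Module.End.HasEigenvalue T lam → lam ≠ 0 → δ ≤ lam) (h : F)
    (hh : ∀ u, T u = 0 → inner ℝ u h = 0) :
    ∃ φ, T φ = h ∧ inner ℝ φ h ≤ ‖h‖ ^ 2 / δ := by
  set b := hT.eigenvectorBasis rfl
  set lam := hT.eigenvalues rfl
  have hTb (i) : T (b i) = lam i • b i := hT.apply_eigenvectorBasis rfl i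
  have hev (i) : Module.End.HasEigenvalue T (lam i) := hT.hasEigenvalue_eigenvalues rfl i
  -- The terms with `lam i = 0` vanish, since `0⁻¹ = 0`.
  refine ⟨∑ i, ((lam i)⁻¹ * inner ℝ (b i) h) • b i, ?_, ?_⟩
  · rw [map_sum]
    conv_rhs => rw [← b.sum_repr' h]
    refine Finset.sum_congr rfl fun i _ => ?_
    rw [map_smul, hTb, smul_smul]
    by_cases h0 : lam i = 0
    · rw [hh (b i) (by rw [hTb, h0, zero_smul])]; simp
    · congr 1; field_simp
  · rw [sum_inner, ← b.sum_sq_inner_right h, Finset.sum_div]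
    refine Finset.sum_le_sum fun i _ => ?_
    rw [real_inner_smul_left]
    by_cases h0 : lam i = 0
    · rw [h0]; simp; positivity
    · have := inv_anti₀ hδ (hgap _ (hev i) h0)
      have h2 := mul_le_mul_of_nonneg_right this (sq_nonneg (inner ℝ (b i) h))
      calc _ = (lam i)⁻¹ * inner ℝ (b i) h ^ 2 := by ring
        _ ≤ _ := h2
        _ = _ := by ring

/-! ### The Laplacian of a graph with resistances -/

namespace ResistorGraph

variable {V E : Type*} (G : ResistorGraph V E)

lemma eq_of_connected {G : ResistorGraph V E} (hc : G.Connected) {α : Type*} {φ : V → α}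
    (h : ∀ e, φ (G.src e) = φ (G.tgt e)) (v w : V) : φ v = φ w := by
  induction hc v w with
  | refl => rfl
  | tail _ hab ih =>
    obtain ⟨e, ⟨rfl, rfl⟩ | ⟨rfl, rfl⟩⟩ := hab
    · exact ih.trans (h e)
    · exact ih.trans (h e).symm

variable [Fintype E] [DecidableEq V]

lemma mem_incident {e : E} {v : V} : e ∈ G.incident v ↔ G.src e = v ∨ G.tgt e = v := by
  simp [incident]

lemma incident_nonempty {G : ResistorGraph V E} (hc : G.Connected) [Nontrivial V] (v : V) :
    (G.incident v).Nonempty := by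
  obtain ⟨w, hw⟩ := exists_ne v
  rcases (hc v w).cases_head with h | ⟨_, ⟨e, h⟩, -⟩
  · exact absurd h.symm hw
  · exact ⟨e, G.mem_incident.2 (h.imp And.left And.right)⟩

lemma vertexRes_pos {G : ResistorGraph V E} (hc : G.Connected) [Nontrivial V] (v : V) :
    0 < G.vertexRes v :=
  inv_pos.2 (Finset.sum_pos (fun e _ => inv_pos.2 (G.res_pos e)) (incident_nonempty hc v))

/-- In the sum of the vertex conductances, a loop counts once and any other edge twice. -/
lemma sum_inv_vertexRes [Fintype V] :
    ∑ v, (G.vertexRes v)⁻¹ =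
      ∑ e, (if G.src e = G.tgt e then 1 else 2) * (G.res e)⁻¹ := by
  simp only [vertexRes, inv_inv, incident, Finset.sum_filter]
  rw [Finset.sum_comm]
  refine Finset.sum_congr rfl fun e _ => ?_
  rw [← Finset.sum_filter, Finset.sum_const, nsmul_eq_mul]
  congr 1
  have : (Finset.univ.filter fun v => G.src e = v ∨ G.tgt e = v) = {G.src e, G.tgt e} := by
    ext v; simp [eq_comm]
  rw [this]
  split_ifs with h
  · simp [h]
  · simp [Finset.card_pair h]

/-- The weighted graph Laplacian: `(L φ)_v` is the net electrical current that leaves `v` when the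
potential is `φ`. -/
noncomputable def laplacian : (V → ℝ) →ₗ[ℝ] (V → ℝ) where
  toFun φ v := ∑ e, ((if G.src e = v then 1 else 0) - (if G.tgt e = v then 1 else 0)) *
    ((φ (G.src e) - φ (G.tgt e)) / G.res e)
  map_add' φ ψ := by
    ext v
    simp only [Pi.add_apply, ← Finset.sum_add_distrib]
    exact Finset.sum_congr rfl fun e _ => by ring
  map_smul' c φ := by
    ext v
    simp only [Pi.smul_apply, smul_eq_mul, RingHom.id_apply, Finset.mul_sum]
    exact Finset.sum_congr rfl fun e _ => by ring

/-- Summation by parts: the Laplacian represents the Dirichlet form of the graph. -/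
lemma sum_mul_laplacian [Fintype V] (φ ψ : V → ℝ) :
    ∑ v, ψ v * G.laplacian φ v =
      ∑ e, (φ (G.src e) - φ (G.tgt e)) / G.res e * (ψ (G.src e) - ψ (G.tgt e)) := by
  simp only [laplacian, LinearMap.coe_mk, AddHom.coe_mk, Finset.mul_sum]
  rw [Finset.sum_comm]
  refine Finset.sum_congr rfl fun e _ => ?_
  simp only [sub_mul, mul_sub, Finset.sum_sub_distrib, ite_mul, mul_ite, one_mul, zero_mul,
    mul_zero, Finset.sum_ite_eq, Finset.mem_univ, if_true]
  ring

/-- The conductance between two vertices is symmetric: `P_{vw} / r_v = P_{wv} / r_w`. -/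
lemma inv_vertexRes_mul_transition_symm {G : ResistorGraph V E} (hc : G.Connected) [Nontrivial V]
    (v w : V) :
    (G.vertexRes v)⁻¹ * G.transition v w = (G.vertexRes w)⁻¹ * G.transition w v := by
  have key (v w : V) : (G.vertexRes v)⁻¹ * G.transition v w =
      ∑ e ∈ Finset.univ.filter (fun e => G.Joins e v w), (G.res e)⁻¹ := by
    rw [transition, Finset.mul_sum]
    refine Finset.sum_congr rfl fun e _ => ?_
    have := (vertexRes_pos hc v).ne'
    field_simp
  rw [key, key]
  exact Finset.sum_congr (Finset.filter_congr fun e _ => or_comm) fun _ _ => rfl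

/-- The Laplacian is `I - P`, rescaled by the conductances `1 / r_v` of the vertices. -/
lemma laplacian_apply {G : ResistorGraph V E} (hc : G.Connected) [Nontrivial V] [Fintype V]
    (φ : V → ℝ) (v : V) :
    G.laplacian φ v = (G.vertexRes v)⁻¹ * (φ v - G.transition.mulVec φ v) := by
  have hv := (vertexRes_pos hc v).ne'
  have h1 : (G.vertexRes v)⁻¹ * φ v =
      ∑ e, if G.src e = v ∨ G.tgt e = v then (G.res e)⁻¹ * φ v else 0 := by
    rw [vertexRes, inv_inv, Finset.sum_mul, incident, Finset.sum_filter]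
  have h2 : (G.vertexRes v)⁻¹ * G.transition.mulVec φ v =
      ∑ e, ∑ w, if G.Joins e v w then (G.res e)⁻¹ * φ w else 0 := by
    simp only [Matrix.mulVec, dotProduct, transition, Finset.mul_sum, Finset.sum_mul]
    rw [Finset.sum_comm]
    refine Finset.sum_congr rfl fun w _ => ?_
    rw [← Finset.sum_filter]
    refine Finset.sum_congr rfl fun e _ => ?_
    field_simp
  rw [mul_sub, h1, h2, ← Finset.sum_sub_distrib]
  simp only [laplacian, LinearMap.coe_mk, AddHom.coe_mk]
  refine Finset.sum_congr rfl fun e _ => ?_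
  by_cases hs : G.src e = v <;> by_cases ht : G.tgt e = v
  · simp [Joins, hs, ht]
  · simp [Joins, hs, ht]; ring
  · simp [Joins, hs, ht]; ring
  · simp [Joins, hs, ht]

lemma eq_of_laplacian_eq_zero {G : ResistorGraph V E} (hc : G.Connected) [Fintype V]
    {φ : V → ℝ} (h : G.laplacian φ = 0) (v w : V) : φ v = φ w := by
  refine eq_of_connected hc (fun e => ?_) v w
  have h0 := G.sum_mul_laplacian φ φ
  rw [h] at h0
  simp only [Pi.zero_apply, mul_zero, Finset.sum_const_zero] at h0
  have hnn (e : E) : 0 ≤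
      (φ (G.src e) - φ (G.tgt e)) / G.res e * (φ (G.src e) - φ (G.tgt e)) := by
    rw [div_mul_eq_mul_div]
    exact div_nonneg (mul_self_nonneg _) (G.res_pos e).le
  have := (Finset.sum_eq_zero_iff_of_nonneg fun e _ => hnn e).1 h0.symm e (Finset.mem_univ e)
  have hr := (G.res_pos e).ne'
  have h3 : φ (G.src e) - φ (G.tgt e) = 0 := by
    simpa [hr] using this
  linarith

/-- The spectrum of `P` away from `1` stays strictly below `1`. -/
lemma lt_one_of_hasEigenvalue {G : ResistorGraph V E} (hc : G.Connected) [Nontrivial V]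
    [Fintype V] {lam : ℝ} (h : Module.End.HasEigenvalue (Matrix.toLin' G.transition) lam)
    (h1 : lam ≠ 1) : lam < 1 := by
  obtain ⟨φ, hφ⟩ := h.exists_hasEigenvector
  have hP : G.transition.mulVec φ = lam • φ := by simpa using hφ.apply_eq_smul
  have h0 := G.sum_mul_laplacian φ φ
  have h2 : ∑ v, φ v * G.laplacian φ v = (1 - lam) * ∑ v, (G.vertexRes v)⁻¹ * φ v ^ 2 := by
    rw [Finset.mul_sum]
    refine Finset.sum_congr rfl fun v _ => ?_
    rw [laplacian_apply hc, hP, Pi.smul_apply, smul_eq_mul]; ring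
  have hnn : 0 ≤ ∑ v, φ v * G.laplacian φ v := by
    rw [h0]
    refine Finset.sum_nonneg fun e _ => ?_
    rw [div_mul_eq_mul_div]
    exact div_nonneg (mul_self_nonneg _) (G.res_pos e).le
  have hpos : 0 < ∑ v, (G.vertexRes v)⁻¹ * φ v ^ 2 := by
    obtain ⟨v, hv⟩ := Function.ne_iff.1 hφ.2
    refine Finset.sum_pos' (fun v _ => ?_) ⟨v, Finset.mem_univ v, ?_⟩
    · have := vertexRes_pos hc v
      positivity
    · have := vertexRes_pos hc v
      have hv' : φ v ≠ 0 := hv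
      positivity
  rw [h2] at hnn
  have := nonneg_of_mul_nonneg_left hnn hpos
  exact lt_of_le_of_ne (by linarith) h1

/-! ### The spectral gap and electrical flows -/

/-- The Laplacian in the symmetric normalization `D^{-1/2} L D^{-1/2}`, where `D` is the diagonal
matrix of the vertex conductances `1 / r_v`. It is similar to `I - P`. -/
noncomputable def normalizedLaplacian : EuclideanSpace ℝ V →ₗ[ℝ] EuclideanSpace ℝ V where
  toFun u := WithLp.toLp 2 fun v =>
    √(G.vertexRes v) * G.laplacian (fun w => √(G.vertexRes w) * u w) v
  map_add' u u' := by
    ext v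
    have : (fun w => √(G.vertexRes w) * (u + u') w) =
      (fun w => √(G.vertexRes w) * u w) + fun w => √(G.vertexRes w) * u' w := by
      ext w; simp [mul_add]
    change √(G.vertexRes v) * G.laplacian (fun w => √(G.vertexRes w) * (u + u') w) v = _ * _ + _ * _
    rw [this, map_add, Pi.add_apply, mul_add]
  map_smul' c u := by
    ext v
    have : (fun w => √(G.vertexRes w) * (c • u) w) =
      c • (fun w => √(G.vertexRes w) * u w) := by
      ext w; simp; ring
    change √(G.vertexRes v) * G.laplacian (fun w => √(G.vertexRes w) * (c • u) w) v = c * (_ * _)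
    rw [this, map_smul, Pi.smul_apply, smul_eq_mul, mul_left_comm]

@[simp]
lemma normalizedLaplacian_apply (u : EuclideanSpace ℝ V) (v : V) :
    G.normalizedLaplacian u v =
      √(G.vertexRes v) * G.laplacian (fun w => √(G.vertexRes w) * u w) v := rfl

lemma normalizedLaplacian_isSymmetric [Fintype V] : G.normalizedLaplacian.IsSymmetric := by
  have key (u u' : EuclideanSpace ℝ V) : inner ℝ (G.normalizedLaplacian u) u' =
      ∑ e, (√(G.vertexRes (G.src e)) * u (G.src e) - √(G.vertexRes (G.tgt e)) * u (G.tgt e)) /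
        G.res e *
        (√(G.vertexRes (G.src e)) * u' (G.src e) - √(G.vertexRes (G.tgt e)) * u' (G.tgt e)) := by
    have := G.sum_mul_laplacian (fun w => √(G.vertexRes w) * u w)
      (fun w => √(G.vertexRes w) * u' w)
    rw [← this, PiLp.inner_apply]
    refine Finset.sum_congr rfl fun v _ => ?_
    simp; ring
  intro u u'
  rw [key, real_inner_comm, key]
  exact Finset.sum_congr rfl fun e _ => by ring

/-- If `u` is an eigenvector of the normalized Laplacian, then `D^{-1/2} u` is one of `P`. -/
lemma hasEigenvalue_transition {G : ResistorGraph V E} (hc : G.Connected) [Nontrivial V]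
    [Fintype V] {lam : ℝ} (h : Module.End.HasEigenvalue G.normalizedLaplacian lam) :
    Module.End.HasEigenvalue (Matrix.toLin' G.transition) (1 - lam) := by
  obtain ⟨u, hu⟩ := h.exists_hasEigenvector
  have hr (v) : 0 < √(G.vertexRes v) := Real.sqrt_pos.2 (vertexRes_pos hc v)
  refine Module.End.hasEigenvalue_of_hasEigenvector (x := fun w => √(G.vertexRes w) * u w)
    (Module.End.hasEigenvector_iff.2 ⟨Module.End.mem_eigenspace_iff.2 ?_, ?_⟩)
  · ext v
    have h1 := congrArg (fun z : EuclideanSpace ℝ V => z v) hu.apply_eq_smul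
    simp only [normalizedLaplacian_apply, laplacian_apply hc, PiLp.smul_apply, smul_eq_mul] at h1
    rw [Matrix.toLin'_apply, Pi.smul_apply, smul_eq_mul]
    have h2 : (G.vertexRes v)⁻¹ = (√(G.vertexRes v) ^ 2)⁻¹ := by
      rw [Real.sq_sqrt (vertexRes_pos hc v).le]
    have h3 := (hr v).ne'
    rw [h2] at h1
    field_simp at h1
    linarith
  · intro h0
    refine hu.2 ?_
    ext v
    have := congrFun h0 v
    simpa [(hr v).ne'] using this

lemma laplacian_eq_zero_of_normalizedLaplacian {G : ResistorGraph V E} (hc : G.Connected)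
    [Nontrivial V] {u : EuclideanSpace ℝ V} (h : G.normalizedLaplacian u = 0) :
    G.laplacian (fun w => √(G.vertexRes w) * u w) = 0 := by
  ext v
  have h1 := congrArg (fun z : EuclideanSpace ℝ V => z v) h
  simpa [(vertexRes_pos hc v).ne', (Real.sqrt_pos.2 (vertexRes_pos hc v)).ne'] using h1

lemma finite_gaps [Fintype V] : {γ : ℝ | ∃ lam : ℝ, Module.End.HasEigenvalue
    (Matrix.toLin' G.transition) lam ∧ lam ≠ 1 ∧ γ = 1 - lam}.Finite := by
  refine ((Module.End.finite_hasEigenvalue (Matrix.toLin' G.transition)).image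
    (fun lam => 1 - lam)).subset ?_
  rintro γ ⟨lam, h, -, rfl⟩
  exact ⟨lam, h, rfl⟩

lemma spectralGap_le {G : ResistorGraph V E} (hc : G.Connected) [Nontrivial V] [Fintype V]
    {lam : ℝ} (h : Module.End.HasEigenvalue G.normalizedLaplacian lam) (h0 : lam ≠ 0) :
    spectralGap G.transition ≤ lam :=
  csInf_le G.finite_gaps.bddBelow
    ⟨1 - lam, hasEigenvalue_transition hc h, by simpa using h0, by ring⟩

lemma spectralGap_pos {G : ResistorGraph V E} (hc : G.Connected) [Nontrivial V] [Fintype V] :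
    0 < spectralGap G.transition := by
  have hT := G.normalizedLaplacian_isSymmetric
  -- If `0` were the only eigenvalue of the Laplacian, then the Laplacian would vanish and every
  -- function would be constant.
  have hne : ∃ lam, Module.End.HasEigenvalue G.normalizedLaplacian lam ∧ lam ≠ 0 := by
    by_contra! hcon
    have hz (u) : G.normalizedLaplacian u = 0 := by
      rw [← (hT.eigenvectorBasis rfl).sum_repr' u, map_sum]
      refine Finset.sum_eq_zero fun i _ => ?_
      rw [map_smul, hT.apply_eigenvectorBasis rfl i, hcon _ (hT.hasEigenvalue_eigenvalues rfl i)]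
      simp
    obtain ⟨v, w, hvw⟩ := exists_pair_ne V
    have := eq_of_laplacian_eq_zero hc
      (laplacian_eq_zero_of_normalizedLaplacian hc (hz (EuclideanSpace.single v 1))) v w
    simp [hvw.symm, (Real.sqrt_pos.2 (vertexRes_pos hc v)).ne'] at this
  obtain ⟨lam, h, h0⟩ := hne
  obtain ⟨lam', h', h1, h2⟩ := Set.Nonempty.csInf_mem (s := {γ : ℝ | ∃ lam : ℝ,
      Module.End.HasEigenvalue (Matrix.toLin' G.transition) lam ∧ lam ≠ 1 ∧ γ = 1 - lam})
    ⟨lam, 1 - lam, hasEigenvalue_transition hc h, by simpa using h0, by ring⟩ G.finite_gaps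
  rw [spectralGap, h2]
  linarith [lt_one_of_hasEigenvalue hc h' h1]

/-- The Poisson equation on the graph is solvable for balanced currents, and the spectral gap
bounds the dissipated energy. -/
lemma exists_laplacian_eq {G : ResistorGraph V E} (hc : G.Connected) [Nontrivial V] [Fintype V]
    {ρ : V → ℝ} (hρ : ∑ v, ρ v = 0) :
    ∃ φ : V → ℝ, G.laplacian φ = ρ ∧
      ∑ v, φ v * ρ v ≤ (∑ v, G.vertexRes v * ρ v ^ 2) / spectralGap G.transition := by
  have hr (v) : √(G.vertexRes v) ≠ 0 := (Real.sqrt_pos.2 (vertexRes_pos hc v)).ne'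
  have hsq (v) : √(G.vertexRes v) ^ 2 = G.vertexRes v := Real.sq_sqrt (vertexRes_pos hc v).le
  obtain ⟨u, hu, hle⟩ := G.normalizedLaplacian_isSymmetric.exists_apply_eq_of_eigenvalue_gap
    (spectralGap_pos hc) (fun lam => spectralGap_le hc)
    (WithLp.toLp 2 fun v => √(G.vertexRes v) * ρ v) (by
      intro u hu
      obtain ⟨v₀⟩ : Nonempty V := inferInstance
      have hconst := eq_of_laplacian_eq_zero hc (laplacian_eq_zero_of_normalizedLaplacian hc hu)
      calc _ = ∑ v, (√(G.vertexRes v) * u v) * ρ v := by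
            rw [PiLp.inner_apply]
            exact Finset.sum_congr rfl fun v _ => by simp; ring
        _ = ∑ v, (√(G.vertexRes v₀) * u v₀) * ρ v :=
            Finset.sum_congr rfl fun v _ => by rw [hconst v v₀]
        _ = 0 := by rw [← Finset.mul_sum, hρ, mul_zero])
  refine ⟨fun v => √(G.vertexRes v) * u v, ?_, ?_⟩
  · ext v
    have h1 := congrArg (fun z : EuclideanSpace ℝ V => z v) hu
    exact mul_left_cancel₀ (hr v) (by simpa using h1)
  · rw [EuclideanSpace.real_norm_sq_eq] at hle
    convert hle using 2
    · rw [PiLp.inner_apply]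
      exact Finset.sum_congr rfl fun v _ => by simp; ring
    · exact Finset.sum_congr rfl fun v _ => by simp [mul_pow, hsq]

/-- The stationary distribution is proportional to the vertex conductances. The constant is `1`
for graphs without loops; loops count only once in `1 / r_v`, which may raise it up to `2`. -/
lemma exists_stationary_eq {G : ResistorGraph V E} (hc : G.Connected) [Nontrivial V] [Fintype V]
    (hG : ∑ e, (G.res e)⁻¹ = 1 / 2) {μ : V → ℝ} (hμ : IsStationaryDistribution G.transition μ) :
    ∃ κ : ℝ, 1 ≤ κ ∧ κ ≤ 2 ∧ ∀ v, μ v = κ * (G.vertexRes v)⁻¹ := by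
  obtain ⟨⟨-, hsum⟩, hst⟩ := hμ
  have hr (v) : G.vertexRes v ≠ 0 := (vertexRes_pos hc v).ne'
  obtain ⟨v₀⟩ : Nonempty V := inferInstance
  have hL : G.laplacian (fun v => G.vertexRes v * μ v) = 0 := by
    ext w
    have h1 := congrFun hst w
    rw [laplacian_apply hc, mul_sub, Matrix.mulVec, dotProduct, Finset.mul_sum]
    have : ∑ v, (G.vertexRes w)⁻¹ * (G.transition w v * (G.vertexRes v * μ v)) = μ w := by
      rw [← h1, Matrix.vecMul, dotProduct]
      refine Finset.sum_congr rfl fun v _ => ?_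
      rw [← mul_assoc, ← inv_vertexRes_mul_transition_symm hc v w]
      have := hr v
      field_simp
    have hw := hr w
    rw [this]
    simp [hw]
  have hconst := eq_of_laplacian_eq_zero hc hL
  have hμ (v) : μ v = (G.vertexRes v₀ * μ v₀) * (G.vertexRes v)⁻¹ := by
    have := hconst v v₀
    have := hr v
    field_simp
    linarith
  refine ⟨G.vertexRes v₀ * μ v₀, ?_, ?_, hμ⟩
  all_goals
    set κ := G.vertexRes v₀ * μ v₀
    have h1 : κ * ∑ v, (G.vertexRes v)⁻¹ = 1 := by
      rw [Finset.mul_sum, ← hsum]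
      exact Finset.sum_congr rfl fun v _ => (hμ v).symm
    have h2 : ∑ v, (G.vertexRes v)⁻¹ ≤ 1 := by
      rw [sum_inv_vertexRes]
      calc _ ≤ ∑ e, 2 * (G.res e)⁻¹ := by
            refine Finset.sum_le_sum fun e _ => ?_
            have := inv_pos.2 (G.res_pos e)
            split_ifs <;> linarith
        _ = 1 := by rw [← Finset.mul_sum, hG]; norm_num
    have h3 : 1 / 2 ≤ ∑ v, (G.vertexRes v)⁻¹ := by
      rw [sum_inv_vertexRes, ← hG]
      refine Finset.sum_le_sum fun e _ => ?_
      have := inv_pos.2 (G.res_pos e)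
      split_ifs <;> linarith
    nlinarith

lemma stationary_pos {G : ResistorGraph V E} (hc : G.Connected) [Nontrivial V] [Fintype V]
    (hG : ∑ e, (G.res e)⁻¹ = 1 / 2) {μ : V → ℝ} (hμ : IsStationaryDistribution G.transition μ)
    (v : V) : 0 < μ v := by
  obtain ⟨κ, hκ1, -, hκ⟩ := exists_stationary_eq hc hG hμ
  rw [hκ]
  have := vertexRes_pos hc v
  positivity

/-- The electrical flow that carries the stationary distribution to its restriction to a set `M`
of vertices, renormalized. The `χ²`-distance between the two distributions is at most
`1 / μ(M)`, so the spectral gap yields the bound on the energy. -/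
lemma exists_flow {G : ResistorGraph V E} (hc : G.Connected) [Nontrivial V] [Fintype V]
    (hG : ∑ e, (G.res e)⁻¹ = 1 / 2) {μ : V → ℝ} (hμ : IsStationaryDistribution G.transition μ)
    {M : Finset V} (hM : M.Nonempty) :
    ∃ f : E → ℝ,
      (∀ g : V → ℝ, ∑ e, f e * (g (G.src e) - g (G.tgt e)) =
        ∑ v, μ v * g v - ∑ v ∈ M, μ v / (∑ w ∈ M, μ w) * g v) ∧
      ∑ e, G.res e * f e ^ 2 ≤ 2 / (spectralGap G.transition * ∑ v ∈ M, μ v) := by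
  obtain ⟨κ, hκ1, hκ2, hκ⟩ := exists_stationary_eq hc hG hμ
  have hr (v) := vertexRes_pos hc v
  have hpos := stationary_pos hc hG hμ
  set m := ∑ w ∈ M, μ w with hm
  have hm0 : 0 < m := Finset.sum_pos (fun v _ => hpos v) hM
  have hsum := hμ.1.2
  -- `q` is the density of the net current with respect to the stationary distribution.
  set q : V → ℝ := fun v => 1 - if v ∈ M then m⁻¹ else 0 with hq
  have hq1 : ∑ v, μ v * q v = 0 := by
    simp only [hq, mul_sub, mul_one, Finset.sum_sub_distrib, hsum, mul_ite, mul_zero]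
    rw [Finset.sum_ite_mem, Finset.univ_inter, ← Finset.sum_mul, ← hm, mul_inv_cancel₀ hm0.ne',
      sub_self]
  have hq2 : ∑ v, μ v * q v ^ 2 ≤ m⁻¹ := by
    have (v : V) : μ v * q v ^ 2 = μ v * q v - (if v ∈ M then μ v * (m⁻¹ - m⁻¹ ^ 2) else 0) := by
      simp only [hq]; split_ifs <;> ring
    simp only [this, Finset.sum_sub_distrib, hq1]
    rw [Finset.sum_ite_mem, Finset.univ_inter, ← Finset.sum_mul, ← hm]
    have : m * (m⁻¹ - m⁻¹ ^ 2) = 1 - m⁻¹ := by field_simp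
    linarith
  obtain ⟨φ, hφ, hle⟩ := exists_laplacian_eq hc hq1
  refine ⟨fun e => (φ (G.src e) - φ (G.tgt e)) / G.res e, fun g => ?_, ?_⟩
  · rw [← G.sum_mul_laplacian φ g, hφ, ← Finset.univ_inter M, ← Finset.sum_ite_mem,
      ← Finset.sum_sub_distrib]
    refine Finset.sum_congr rfl fun v _ => ?_
    simp only [hq]; split_ifs <;> ring
  · have hδ := spectralGap_pos hc
    calc _ = ∑ v, φ v * (μ v * q v) := by
          have := G.sum_mul_laplacian φ φ
          rw [hφ] at this
          rw [this]
          refine Finset.sum_congr rfl fun e _ => ?_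
          have := (G.res_pos e).ne'
          field_simp
      _ ≤ _ := hle
      _ = (κ * ∑ v, μ v * q v ^ 2) / spectralGap G.transition := by
          congr 1
          rw [Finset.mul_sum]
          refine Finset.sum_congr rfl fun v _ => ?_
          rw [hκ v]
          have := (hr v).ne'
          field_simp
      _ ≤ (2 * m⁻¹) / spectralGap G.transition := by
          have : 0 ≤ ∑ v, μ v * q v ^ 2 :=
            Finset.sum_nonneg fun v _ => mul_nonneg (hpos v).le (sq_nonneg _)
          gcongr
      _ = _ := by field_simp

/-- One step of the walk from the stationary distribution traverses every edge `e` with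
probability at least `1 / r_e`. -/
lemma sum_div_res_le_stepExpectation {G : ResistorGraph V E} (hc : G.Connected) [Nontrivial V]
    [Fintype V]
    (hG : ∑ e, (G.res e)⁻¹ = 1 / 2) {μ : V → ℝ} (hμ : IsStationaryDistribution G.transition μ)
    {F : E → ℝ} (hF : ∀ e, 0 ≤ F e) :
    ∑ e, F e / G.res e ≤ G.stepExpectation μ F := by
  obtain ⟨κ, hκ1, -, hκ⟩ := exists_stationary_eq hc hG hμ
  have h0 (e : E) : 0 ≤ F e / G.res e := div_nonneg (hF e) (G.res_pos e).le
  calc ∑ e, F e / G.res e = ∑ e, ∑ v, if G.src e = v then F e / G.res e else 0 := by simp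
    _ ≤ ∑ e, ∑ v, if G.src e = v ∨ G.tgt e = v then κ * (F e / G.res e) else 0 := by
        refine Finset.sum_le_sum fun e _ => Finset.sum_le_sum fun v _ => ?_
        have h1 : F e / G.res e ≤ κ * (F e / G.res e) := le_mul_of_one_le_left (h0 e) hκ1
        have h2 := (h0 e).trans h1
        split_ifs <;> tauto
    _ = G.stepExpectation μ F := by
        rw [Finset.sum_comm, stepExpectation]
        refine Finset.sum_congr rfl fun v _ => ?_
        rw [← Finset.sum_filter, Finset.mul_sum]
        refine Finset.sum_congr rfl fun e _ => ?_
        rw [hκ v]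
        have := (vertexRes_pos hc v).ne'
        field_simp

end ResistorGraph

/-! ### Span programs with prescribed witnesses -/

namespace SpanProgram

variable {X H : Type*} [NormedAddCommGroup H] [InnerProductSpace ℂ H]

lemma posSize_le {P : SpanProgram X H} {x : X} {w : H} (hw : w ∈ P.posWitnesses x) :
    P.posSize x ≤ ‖w‖ ^ 2 :=
  csInf_le ⟨0, by rintro _ ⟨w, -, rfl⟩; positivity⟩ ⟨w, hw, rfl⟩

lemma negSize_le {P : SpanProgram X H} {x : X} {w : H} (hw : w ∈ P.negWitnesses x) :
    P.negSize x ≤ ‖w‖ ^ 2 :=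
  csInf_le ⟨0, by rintro _ ⟨w, -, rfl⟩; positivity⟩ ⟨w, hw, rfl⟩

variable [FiniteDimensional ℂ H]

lemma exists_norm_sq_eq_sInf {s : Set H} (hs : IsClosed s) (hne : s.Nonempty) :
    ∃ w ∈ s, ‖w‖ ^ 2 = sInf ((fun w => ‖w‖ ^ 2) '' s) := by
  have : ProperSpace H := FiniteDimensional.proper ℂ H
  obtain ⟨w, hw, hd⟩ := hs.exists_infDist_eq_dist hne 0
  have hleast : IsLeast ((fun w => ‖w‖ ^ 2) '' s) (‖w‖ ^ 2) := by
    refine ⟨⟨w, hw, rfl⟩, ?_⟩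
    rintro _ ⟨z, hz, rfl⟩
    have := Metric.infDist_le_dist_of_mem (x := (0 : H)) hz
    rw [hd, dist_zero_left, dist_zero_left] at this
    dsimp only
    gcongr
  exact ⟨w, hw, hleast.csInf_eq.symm⟩

lemma IsPositive.exists_posWitness {P : SpanProgram X H} {x : X} (h : P.IsPositive x) :
    ∃ w ∈ P.posWitnesses x, ‖w‖ ^ 2 = P.posSize x := by
  refine exists_norm_sq_eq_sInf ?_ ?_
  · exact (P.avail x).closed_of_finiteDimensional.inter
      (P.ker.closed_of_finiteDimensional.preimage (continuous_id.sub continuous_const))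
  · obtain ⟨k, hk, w, hw, hkw⟩ := Submodule.mem_sup.1 h
    refine ⟨w, hw, ?_⟩
    rw [← hkw, sub_add_cancel_right]
    exact P.ker.neg_mem hk

lemma exists_negWitness {P : SpanProgram X H} {x : X} (h : ¬ P.IsPositive x) :
    ∃ w ∈ P.negWitnesses x, ‖w‖ ^ 2 = P.negSize x := by
  refine exists_norm_sq_eq_sInf ?_ ?_
  · exact (P.avail x).isClosed_orthogonal.inter (P.ker.isClosed_orthogonal.inter
      (isClosed_eq (continuous_const.inner continuous_id) continuous_const))
  · obtain ⟨z, hz, p, hp, hzp⟩ := (P.ker ⊔ P.avail x).exists_add_mem_mem_orthogonal P.target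
    have hp0 : p ≠ 0 := by
      rintro rfl
      exact h (by rw [IsPositive, hzp, add_zero]; exact hz)
    have hin : inner ℂ P.target p = inner ℂ p p := by
      rw [hzp, inner_add_left, Submodule.inner_right_of_mem_orthogonal hz hp, zero_add]
    refine ⟨(inner ℂ p p)⁻¹ • p, Submodule.smul_mem _ _ ?_, Submodule.smul_mem _ _ ?_, ?_⟩
    · exact Submodule.orthogonal_le le_sup_right hp
    · exact Submodule.orthogonal_le le_sup_left hp
    · rw [inner_smul_right, hin, inv_mul_cancel₀ (inner_self_ne_zero.2 hp0)]

/-- A span program can be built around prescribed witnesses: it suffices that every positive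
witness has inner product `1` with every negative witness. The kernel is the orthogonal complement
of the negative witnesses, and all positive witnesses have the same projection, the target, to the
complement of the kernel. -/
lemma exists_of_witnesses (avail : X → Submodule ℂ H) (f : X → Prop) (w : X → H) (C : ℝ)
    (hw : ∀ y, ¬ f y → w y ∈ (avail y)ᗮ)
    (hu : ∀ x, f x → ∃ u ∈ avail x, ‖u‖ ^ 2 ≤ C ∧ ∀ y, ¬ f y → inner ℂ u (w y) = 1)
    (hf : ∃ x, f x) :
    ∃ P : SpanProgram X H, (∀ x, P.avail x = avail x) ∧ P.Computes f ∧
      (∀ x, f x → P.posSize x ≤ C) ∧ ∀ y, ¬ f y → P.negSize y ≤ ‖w y‖ ^ 2 := by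
  obtain ⟨x₀, hx₀⟩ := hf
  obtain ⟨u₀, -, -, hu₀⟩ := hu x₀ hx₀
  set N := Submodule.span ℂ {z | ∃ y, ¬ f y ∧ z = w y} with hN
  have hwN {y} (hy : ¬ f y) : w y ∈ N := Submodule.subset_span ⟨y, hy, rfl⟩
  obtain ⟨t, ht, t', ht', hut⟩ := N.exists_add_mem_mem_orthogonal u₀
  have hinner {y} (hy : ¬ f y) : inner ℂ t (w y) = 1 := by
    rw [← hu₀ y hy, hut, inner_add_left, Submodule.inner_left_of_mem_orthogonal (hwN hy) ht',
      add_zero]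
  let P : SpanProgram X H := ⟨avail, Nᗮ, t, by rwa [Submodule.orthogonal_orthogonal]⟩
  have hpos {x} {u : H} (hux : u ∈ avail x) (h1 : ∀ y, ¬ f y → inner ℂ u (w y) = 1) :
      u ∈ P.posWitnesses x := by
    refine ⟨hux, ?_⟩
    change u - t ∈ Nᗮ
    rw [Submodule.mem_orthogonal']
    intro z hz
    induction hz using Submodule.span_induction with
    | mem z hz =>
      obtain ⟨y, hy, rfl⟩ := hz
      rw [inner_sub_left, h1 y hy, hinner hy, sub_self]
    | zero => simp
    | add a b _ _ ha hb => rw [inner_add_right, ha, hb, add_zero]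
    | smul c a _ ha => rw [inner_smul_right, ha, mul_zero]
  have hneg {y} (hy : ¬ f y) : w y ∈ P.negWitnesses y :=
    ⟨hw y hy, Submodule.le_orthogonal_orthogonal _ (hwN hy), hinner hy⟩
  refine ⟨P, fun _ => rfl, fun x => ⟨fun h => ?_, fun hx => ?_⟩, fun x hx => ?_,
    fun y hy => negSize_le (hneg hy)⟩
  · by_contra hx
    obtain ⟨k, hk, a, ha, hka⟩ := Submodule.mem_sup.1 h
    obtain ⟨h1, h2, h3⟩ := hneg hx
    rw [← hka, inner_add_left, Submodule.inner_right_of_mem_orthogonal hk h2,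
      Submodule.inner_right_of_mem_orthogonal ha h1] at h3
    simp at h3
  · obtain ⟨u, hux, -, h1⟩ := hu x hx
    obtain ⟨ha, hk⟩ := hpos hux h1
    refine Submodule.mem_sup.2 ⟨P.target - u, ?_, u, ha, sub_add_cancel _ _⟩
    rw [← neg_sub]
    exact P.ker.neg_mem hk
  · obtain ⟨u, hux, hC, h1⟩ := hu x hx
    exact (posSize_le (hpos hux h1)).trans hC

end SpanProgram

/-! ### Witnesses of state-reflection problems -/

section Reflections

variable {X H : Type*} [NormedAddCommGroup H] [InnerProductSpace ℂ H]

lemma ReflectionOracle.mem_plusSpace_orthogonal {O : ReflectionOracle X H} {x : X} {w : H}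
    (h : O.op x w = -w) : w ∈ (O.plusSpace x)ᗮ := by
  rw [Submodule.mem_orthogonal]
  intro z hz
  have hz' : O.op x z = z := by
    simpa [ReflectionOracle.plusSpace, Module.End.mem_eigenspace_iff] using hz
  have := O.symm x z w
  rw [hz', h, inner_neg_right] at this
  exact self_eq_neg.1 this

variable {W : Type*} [NormedAddCommGroup W] [InnerProductSpace ℂ W]

/-- Between opposite signs, feasibility says that the witnesses have the same inner products as the
states. -/
lemma StateReflection.Solution.inner_witness {R : StateReflection X W H} (s : R.Solution)
    (x y : X) :
    inner ℂ (s.witness true x) (s.witness false y) =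
      inner ℂ (R.state true x) (R.state false y) := by
  have h := s.feasible (true, x) (false, y)
  simp only [toConversion, s.eigen, signOf, if_true, inner_smul_left, inner_smul_right,
    Bool.false_eq_true, if_false] at h
  simp only [map_one, one_mul, neg_mul, sub_neg_eq_add, ← two_mul] at h
  exact (mul_left_cancel₀ two_ne_zero h).symm

lemma StateReflection.Solution.witness_true_mem {R : StateReflection X W H} (s : R.Solution)
    (x : X) : s.witness true x ∈ R.oracle.plusSpace x :=
  Module.End.mem_eigenspace_iff.2 (by simpa [signOf] using s.eigen true x)

lemma StateReflection.Solution.witness_false_mem {R : StateReflection X W H} (s : R.Solution)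
    (x : X) : s.witness false x ∈ (R.oracle.plusSpace x)ᗮ :=
  ReflectionOracle.mem_plusSpace_orthogonal (by simpa [signOf] using s.eigen false x)

lemma inner_witness_registerUpdate {ι : Type*} [Fintype ι] [DecidableEq ι] {ξ η : X → ι}
    {O : ReflectionOracle X H} (s : (registerUpdate ξ η O).Solution) (x y : X) :
    inner ℂ (s.witness true x) (s.witness false y) =
      (if ξ x = ξ y then 1 else 0) + (if ξ x = η y then 1 else 0)
        - (if η x = ξ y then 1 else 0) - (if η x = η y then 1 else 0) := by
  rw [s.inner_witness]
  simp only [registerUpdate, if_true, Bool.false_eq_true, if_false, inner_sub_left,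
    inner_add_right, EuclideanSpace.inner_single_left, PiLp.single_apply, map_one, one_mul]
  ring

/-- Reweighting a pair of witnesses by `1 / s` and `s` does not change their inner product. A zero
weight is admissible if the inner product vanishes anyway. -/
lemma inner_div_smul_smul {α s : ℝ} {z z' : H} (h : s = 0 → z = 0) :
    inner ℂ (((α / s : ℝ) : ℂ) • z) ((s : ℂ) • z') = α * inner ℂ z z' := by
  rw [inner_smul_left, inner_smul_right, Complex.conj_ofReal]
  by_cases hs : s = 0
  · simp [h hs]
  · have : (s : ℂ) ≠ 0 := by exact_mod_cast hs
    push_cast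
    field_simp

lemma norm_sq_smul_sqrt {W : ℝ} (hW : 0 ≤ W) (z : H) : ‖((√W : ℝ) : ℂ) • z‖ ^ 2 = W * ‖z‖ ^ 2 := by
  rw [norm_smul, mul_pow, Complex.norm_real, Real.norm_eq_abs, sq_abs, Real.sq_sqrt hW]

lemma norm_sq_smul_div_sqrt {W : ℝ} (hW : 0 ≤ W) (α : ℝ) (z : H) :
    ‖((α / √W : ℝ) : ℂ) • z‖ ^ 2 = α ^ 2 / W * ‖z‖ ^ 2 := by
  rw [norm_smul, mul_pow, Complex.norm_real, Real.norm_eq_abs, sq_abs, div_pow, Real.sq_sqrt hW]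

end Reflections

/-- The bound includes `C = 0`, where both `z` and the junk value of the quotient are `0`. -/
lemma sq_div_mul_mul_le {α C t z : ℝ} (ht : 0 < t) (hz : z ≤ C) (hz0 : 0 ≤ z) :
    α ^ 2 / (C * t) * z ≤ α ^ 2 / t := by
  have hC := hz0.trans hz
  calc _ ≤ α ^ 2 / (C * t) * C := by gcongr
    _ = α ^ 2 / t * (C / C) := by ring
    _ ≤ α ^ 2 / t * 1 := by gcongr; exact div_self_le_one C
    _ = _ := mul_one _

/-! ### The direct sum of the routines -/

section Assemble

variable {V E S : Type*} {H : Routine V E S → Type*}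

/-- The vector in the direct sum of all routines that has given components in the setup, update and
checking routines. -/
def assemble (s : ∀ v, H (.inl v)) (u : ∀ e, H (.inr (.inl e))) (k : ∀ p, H (.inr (.inr p))) :
    PiLp 2 H :=
  WithLp.toLp 2 fun
    | .inl v => s v
    | .inr (.inl e) => u e
    | .inr (.inr p) => k p

variable [Fintype V] [Fintype E] [Fintype S]
  [∀ i, NormedAddCommGroup (H i)]

lemma inner_assemble [∀ i, InnerProductSpace ℂ (H i)] (s s' : ∀ v, H (.inl v))
    (u u' : ∀ e, H (.inr (.inl e))) (k k' : ∀ p, H (.inr (.inr p))) :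
    inner ℂ (assemble s u k) (assemble s' u' k') =
      ∑ v, inner ℂ (s v) (s' v) + (∑ e, inner ℂ (u e) (u' e) + ∑ p, inner ℂ (k p) (k' p)) := by
  rw [PiLp.inner_apply, Fintype.sum_sum_type, Fintype.sum_sum_type]
  rfl

lemma norm_sq_assemble (s : ∀ v, H (.inl v)) (u : ∀ e, H (.inr (.inl e)))
    (k : ∀ p, H (.inr (.inr p))) :
    ‖assemble s u k‖ ^ 2 =
      ∑ v, ‖s v‖ ^ 2 + (∑ e, ‖u e‖ ^ 2 + ∑ p, ‖k p‖ ^ 2) := by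
  rw [PiLp.norm_sq_eq_of_L2, Fintype.sum_sum_type, Fintype.sum_sum_type]
  rfl

end Assemble

namespace QuantumWalkSearch

variable {V E X S : Type*} [Fintype V] [DecidableEq V] [Fintype E]
  [Fintype S] [DecidableEq S] {H : Routine V E S → Type*}
  [∀ i, NormedAddCommGroup (H i)] [∀ i, InnerProductSpace ℂ (H i)]
  (Q : QuantumWalkSearch V E X S H)

lemma assemble_mem_totalAvail {x : X} {s : ∀ v, H (.inl v)} {u : ∀ e, H (.inr (.inl e))}
    {k : ∀ p, H (.inr (.inr p))} (hs : ∀ v, s v ∈ (Q.setupOracle v).plusSpace x)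
    (hu : ∀ e, u e ∈ (Q.updateOracle e).plusSpace x) (hk : ∀ p, k p ∈ (Q.check p).avail x) :
    assemble s u k ∈ Q.totalAvail x
  | .inl v => hs v
  | .inr (.inl e) => hu e
  | .inr (.inr p) => hk p

lemma assemble_mem_totalAvail_orthogonal {x : X} {s : ∀ v, H (.inl v)}
    {u : ∀ e, H (.inr (.inl e))} {k : ∀ p, H (.inr (.inr p))}
    (hs : ∀ v, s v ∈ ((Q.setupOracle v).plusSpace x)ᗮ)
    (hu : ∀ e, u e ∈ ((Q.updateOracle e).plusSpace x)ᗮ)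
    (hk : ∀ p, k p ∈ ((Q.check p).avail x)ᗮ) :
    assemble s u k ∈ (Q.totalAvail x)ᗮ := by
  rw [Submodule.mem_orthogonal]
  intro z hz
  rw [PiLp.inner_apply]
  refine Finset.sum_eq_zero fun i _ => ?_
  have hzi := hz i
  rcases i with v | e | p
  · exact Submodule.inner_right_of_mem_orthogonal hzi (hs v)
  · exact Submodule.inner_right_of_mem_orthogonal hzi (hu e)
  · exact Submodule.inner_right_of_mem_orthogonal hzi (hk p)

/-- The flow from the blank register into the entry on `x` feels the potential of the entry on `y`
only if the two entries agree. -/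
lemma inner_setup (v : V) (x y : X) :
    inner ℂ ((Q.setup v).witness true x) ((Q.setup v).witness false y) =
      ((1 - if Q.data v x = Q.data v y then 1 else 0 : ℝ) : ℂ) := by
  rw [inner_witness_registerUpdate]
  simp [apply_ite Complex.ofReal]

lemma inner_update (e : E) (x y : X) :
    inner ℂ ((Q.update e).witness true x) ((Q.update e).witness false y) =
      (((if Q.data (Q.graph.src e) x = Q.data (Q.graph.src e) y then 1 else 0)
        - if Q.data (Q.graph.tgt e) x = Q.data (Q.graph.tgt e) y then 1 else 0 : ℝ) : ℂ) := by
  rw [inner_witness_registerUpdate]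
  -- At a loop the net-flow `ξ - η` vanishes; otherwise the mixed terms do.
  by_cases h : Q.graph.src e = Q.graph.tgt e
  · simp [h]
  · simp [h, Ne.symm h, apply_ite Complex.ofReal]

lemma setup_size_le [Finite X] {x : X} (hx : Q.HasMarked x) (v : V) :
    ‖(Q.setup v).witness true x‖ ^ 2 ≤ Q.setupPlus v :=
  le_ciSup (f := fun x : {x // Q.HasMarked x} => (Q.setup v).size true x)
    (Set.finite_range _).bddAbove ⟨x, hx⟩

lemma update_size_le [Finite X] {x : X} (hx : Q.HasMarked x) (e : E) :
    ‖(Q.update e).witness true x‖ ^ 2 ≤ Q.updatePlus e :=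
  le_ciSup (f := fun x : {x // Q.HasMarked x} => (Q.update e).size true x)
    (Set.finite_range _).bddAbove ⟨x, hx⟩

lemma posSize_check_le [Finite X] {x : X} (hx : Q.HasMarked x) (v : V) (d : S) :
    (Q.check (v, d)).posSize x ≤ Q.checkPlus v d :=
  le_ciSup (f := fun x : {x // Q.HasMarked x} => (Q.check (v, d)).posSize x)
    (Set.finite_range _).bddAbove ⟨x, hx⟩

lemma markedFraction_le [Finite X] (μ : V → ℝ) {x : X} (hx : Q.HasMarked x) :
    Q.markedFraction μ ≤ ∑ v ∈ Q.marked x, μ v :=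
  ciInf_le (f := fun x : {x // Q.HasMarked x} => ∑ v ∈ Q.marked x, μ v)
    (Set.finite_range _).bddBelow ⟨x, hx⟩

lemma markedFraction_pos [Finite X] {μ : V → ℝ} (hμ : ∀ v, 0 < μ v) (h : ∃ x, Q.HasMarked x) :
    0 < Q.markedFraction μ := by
  obtain ⟨x, hx⟩ := h
  have : Nonempty {x // Q.HasMarked x} := ⟨⟨x, hx⟩⟩
  obtain ⟨x', hx'⟩ := exists_eq_ciInf_of_finite
    (f := fun x : {x // Q.HasMarked x} => ∑ v ∈ Q.marked x, μ v)
  rw [markedFraction, ← hx']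
  exact Finset.sum_pos (fun v _ => hμ v) x'.2

/-! ### Witnesses of the search -/

/-- The negative witness of the search: all vertices have potential `1`, so every routine
contributes its own negative witness. The routines carry the weights `√a`, `√b`, `√c`; the checking
routines contribute only where their database entry is the actual one. -/
noncomputable def negVec (a : V → ℝ) (b : E → ℝ) (c : V × S → ℝ)
    (nw : ∀ p : V × S, X → H (.inr (.inr p))) (y : X) : PiLp 2 H :=
  assemble (fun v => ((√(a v) : ℝ) : ℂ) • (Q.setup v).witness false y)
    (fun e => ((√(b e) : ℝ) : ℂ) • (Q.update e).witness false y)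
    (fun p => if p.2 = Q.data p.1 y then ((√(c p) : ℝ) : ℂ) • nw p y else 0)

/-- The positive witness of the search: a unit flow enters at the vertices through the setup
routines in the amounts `μ`, runs along the edges as `f`, and leaves through the checking routines
of the marked vertices in the amounts `k`. The weights are the inverses of those of `negVec`. -/
noncomputable def posVec (a : V → ℝ) (b : E → ℝ) (c : V × S → ℝ)
    (pw : ∀ p : V × S, H (.inr (.inr p))) (μ : V → ℝ) (f : E → ℝ) (k : V → ℝ) (x : X) : PiLp 2 H :=
  assemble (fun v => ((μ v / √(a v) : ℝ) : ℂ) • (Q.setup v).witness true x)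
    (fun e => ((f e / √(b e) : ℝ) : ℂ) • (Q.update e).witness true x)
    (fun p => if p.1 ∈ Q.marked x ∧ p.2 = Q.data p.1 x
      then ((k p.1 / √(c p) : ℝ) : ℂ) • pw p else 0)

variable {Q}

lemma negVec_mem_orthogonal {a : V → ℝ} {b : E → ℝ} {c : V × S → ℝ}
    {nw : ∀ p : V × S, X → H (.inr (.inr p))} {y : X}
    (hnw : ∀ v, nw (v, Q.data v y) y ∈ (Q.check (v, Q.data v y)).negWitnesses y) :
    Q.negVec a b c nw y ∈ (Q.totalAvail y)ᗮ := by
  refine Q.assemble_mem_totalAvail_orthogonal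
    (fun v => Submodule.smul_mem _ _ ((Q.setup v).witness_false_mem y))
    (fun e => Submodule.smul_mem _ _ ((Q.update e).witness_false_mem y)) ?_
  rintro ⟨v, d⟩
  dsimp only
  split_ifs with h
  · subst h
    exact Submodule.smul_mem _ _ (hnw v).1
  · exact Submodule.zero_mem _

lemma posVec_mem {a : V → ℝ} {b : E → ℝ} {c : V × S → ℝ} {pw : ∀ p : V × S, H (.inr (.inr p))}
    {μ k : V → ℝ} {f : E → ℝ} {x : X}
    (hpw : ∀ v ∈ Q.marked x, pw (v, Q.data v x) ∈ (Q.check (v, Q.data v x)).posWitnesses x) :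
    Q.posVec a b c pw μ f k x ∈ Q.totalAvail x := by
  refine Q.assemble_mem_totalAvail
    (fun v => Submodule.smul_mem _ _ ((Q.setup v).witness_true_mem x))
    (fun e => Submodule.smul_mem _ _ ((Q.update e).witness_true_mem x)) ?_
  rintro ⟨v, d⟩
  dsimp only
  split_ifs with h
  · obtain ⟨hv, rfl⟩ := h
    exact Submodule.smul_mem _ _ (hpw v hv).1
  · exact Submodule.zero_mem _

/-- Let `g v` indicate that the database entries of `v` agree on `x` and `y`. The setup, update and
checking routines contribute `∑ v, μ v * (1 - g v)`, the work of the flow `f` against the potential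
`g`, and `∑ v, k v * g v`, respectively. By Kirchhoff's law these sum to `1`. -/
lemma inner_posVec_negVec {a : V → ℝ} {b : E → ℝ} {c : V × S → ℝ}
    {pw : ∀ p : V × S, H (.inr (.inr p))} {nw : ∀ p : V × S, X → H (.inr (.inr p))}
    {μ k : V → ℝ} {f : E → ℝ} {x y : X}
    (hpw : ∀ v ∈ Q.marked x, pw (v, Q.data v x) ∈ (Q.check (v, Q.data v x)).posWitnesses x)
    (hnw : ∀ v, nw (v, Q.data v y) y ∈ (Q.check (v, Q.data v y)).negWitnesses y)
    (ha : ∀ v, √(a v) = 0 → (Q.setup v).witness true x = 0)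
    (hb : ∀ e, √(b e) = 0 → (Q.update e).witness true x = 0)
    (hc : ∀ v ∈ Q.marked x, √(c (v, Q.data v x)) = 0 → pw (v, Q.data v x) = 0)
    (hμ : ∑ v, μ v = 1)
    (hf : ∀ g : V → ℝ, ∑ e, f e * (g (Q.graph.src e) - g (Q.graph.tgt e)) =
      ∑ v, μ v * g v - ∑ v ∈ Q.marked x, k v * g v) :
    inner ℂ (Q.posVec a b c pw μ f k x) (Q.negVec a b c nw y) = 1 := by
  set g : V → ℝ := fun v => if Q.data v x = Q.data v y then 1 else 0 with hg
  have h1 (v : V) : inner ℂ (((μ v / √(a v) : ℝ) : ℂ) • (Q.setup v).witness true x)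
      (((√(a v) : ℝ) : ℂ) • (Q.setup v).witness false y) = ((μ v * (1 - g v) : ℝ) : ℂ) := by
    rw [inner_div_smul_smul (ha v), inner_setup, Complex.ofReal_mul]
  have h2 (e : E) : inner ℂ (((f e / √(b e) : ℝ) : ℂ) • (Q.update e).witness true x)
      (((√(b e) : ℝ) : ℂ) • (Q.update e).witness false y) =
      ((f e * (g (Q.graph.src e) - g (Q.graph.tgt e)) : ℝ) : ℂ) := by
    rw [inner_div_smul_smul (hb e), inner_update, Complex.ofReal_mul]
  have h3 (v : V) : ∑ d : S, inner ℂ (if v ∈ Q.marked x ∧ d = Q.data v x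
        then ((k v / √(c (v, d)) : ℝ) : ℂ) • pw (v, d) else 0)
      (if d = Q.data v y then ((√(c (v, d)) : ℝ) : ℂ) • nw (v, d) y else 0) =
      (((if v ∈ Q.marked x then k v * g v else 0) : ℝ) : ℂ) := by
    rw [Finset.sum_eq_single (Q.data v x)]
    · by_cases hv : v ∈ Q.marked x
      · by_cases hxy : Q.data v x = Q.data v y
        · have hp := hpw v hv
          have hn := hnw v
          have hz := hc v hv
          rw [← hxy] at hn
          rw [if_pos ⟨hv, rfl⟩, if_pos hxy, inner_div_smul_smul hz, if_pos hv]
          have : pw (v, Q.data v x) =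
              (pw (v, Q.data v x) - (Q.check (v, Q.data v x)).target) +
                (Q.check (v, Q.data v x)).target := (sub_add_cancel _ _).symm
          rw [this, inner_add_left, Submodule.inner_right_of_mem_orthogonal hp.2 hn.2.1, hn.2.2]
          simp [hg, hxy]
        · simp [hg, hxy]
      · simp [hv]
    · intro d _ hd
      simp [hd]
    · simp
  rw [posVec, negVec, inner_assemble, Fintype.sum_prod_type]
  dsimp only
  simp only [h1, h2, h3]
  rw [← Complex.ofReal_sum, ← Complex.ofReal_sum, ← Complex.ofReal_sum, ← Complex.ofReal_add,
    ← Complex.ofReal_add, hf g, Finset.sum_ite_mem, Finset.univ_inter]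
  simp only [mul_sub, mul_one, Finset.sum_sub_distrib, hμ]
  norm_num

lemma norm_sq_negVec {a : V → ℝ} {b : E → ℝ} {c : V × S → ℝ}
    {nw : ∀ p : V × S, X → H (.inr (.inr p))} (ha : ∀ v, 0 ≤ a v) (hb : ∀ e, 0 ≤ b e)
    (hc : ∀ p, 0 ≤ c p) (y : X) :
    ‖Q.negVec a b c nw y‖ ^ 2 = ∑ v, a v * (Q.setup v).size false y +
      (∑ e, b e * (Q.update e).size false y +
        ∑ v, c (v, Q.data v y) * ‖nw (v, Q.data v y) y‖ ^ 2) := by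
  rw [negVec, norm_sq_assemble, Fintype.sum_prod_type]
  simp only [norm_sq_smul_sqrt (ha _), norm_sq_smul_sqrt (hb _), StateReflection.Solution.size]
  congr 2
  refine Finset.sum_congr rfl fun v _ => ?_
  rw [Finset.sum_eq_single (Q.data v y)]
  · rw [if_pos rfl, norm_sq_smul_sqrt (hc _)]
  · intro d _ hd
    simp [hd]
  · simp

lemma norm_sq_posVec {a : V → ℝ} {b : E → ℝ} {c : V × S → ℝ}
    {pw : ∀ p : V × S, H (.inr (.inr p))} (ha : ∀ v, 0 ≤ a v) (hb : ∀ e, 0 ≤ b e)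
    (hc : ∀ p, 0 ≤ c p) (μ k : V → ℝ) (f : E → ℝ) (x : X) :
    ‖Q.posVec a b c pw μ f k x‖ ^ 2 =
      ∑ v, μ v ^ 2 / a v * ‖(Q.setup v).witness true x‖ ^ 2 +
      (∑ e, f e ^ 2 / b e * ‖(Q.update e).witness true x‖ ^ 2 +
        ∑ v ∈ Q.marked x, k v ^ 2 / c (v, Q.data v x) * ‖pw (v, Q.data v x)‖ ^ 2) := by
  rw [posVec, norm_sq_assemble, Fintype.sum_prod_type]
  simp only [norm_sq_smul_div_sqrt (ha _), norm_sq_smul_div_sqrt (hb _)]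
  congr 2
  conv_rhs => rw [← Finset.univ_inter (Q.marked x), ← Finset.sum_ite_mem]
  refine Finset.sum_congr rfl fun v _ => ?_
  rw [Finset.sum_eq_single (Q.data v x)]
  · by_cases hv : v ∈ Q.marked x
    · rw [if_pos ⟨hv, rfl⟩, norm_sq_smul_div_sqrt (hc _), if_pos hv]
    · simp [hv]
  · intro d _ hd
    simp [hd]
  · simp

end QuantumWalkSearch

theorem mainTheorem4 :
    ∃ c : ℝ, 0 < c ∧
      ∀ (V : Type*) (E : Type*) (X : Type*) (S : Type*)
        [Fintype V] [DecidableEq V] [Nontrivial V] [Fintype E] [Finite X]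
        [Fintype S] [DecidableEq S]
        (H : Routine V E S → Type*)
        [∀ i, NormedAddCommGroup (H i)] [∀ i, InnerProductSpace ℂ (H i)]
        [∀ i, FiniteDimensional ℂ (H i)]
        (Q : QuantumWalkSearch V E X S H)
        (_hpos : ∃ x, Q.HasMarked x)
        (π : V → ℝ) (_hπ : IsStationaryDistribution Q.graph.transition π)
        (δ : ℝ) (_hδ : δ = spectralGap Q.graph.transition)
        (ε : ℝ) (_hε : ε = Q.markedFraction π),
        ∃ P : SpanProgram X (PiLp 2 H),
          (∀ x, P.avail x = Q.totalAvail x) ∧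
          P.Computes Q.HasMarked ∧
          (∀ x, Q.HasMarked x → P.posSize x ≤ c) ∧
          (∀ x, ¬ Q.HasMarked x →
            P.negSize x ≤ c *
              ((∑ v, π v * Q.setupPlus v) * (∑ v, π v * (Q.setup v).size false x)
                + 1 / ε *
                  (1 / δ * Q.graph.stepExpectation π
                      (fun e => Q.updatePlus e * (Q.update e).size false x)
                    + ∑ v, π v * (Q.checkPlus v (Q.data v x)
                        * (Q.check (v, Q.data v x)).negSize x)))) := by
  refine ⟨4, by norm_num, ?_⟩
  intro V E X S _ _ _ _ _ _ _ H _ _ _ Q hpos π hπ δ hδ ε hε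
  have hc := Q.connected
  have hG := Q.total_conductance
  have hδ0 : 0 < δ := hδ ▸ ResistorGraph.spectralGap_pos hc
  have hπ0 := ResistorGraph.stationary_pos hc hG hπ
  have hε0 : 0 < ε := hε ▸ Q.markedFraction_pos hπ0 hpos
  have hr (e) := Q.graph.res_pos e
  obtain ⟨x₀, hx₀⟩ := hpos
  have hS0 (v) : 0 ≤ Q.setupPlus v := (sq_nonneg _).trans (Q.setup_size_le hx₀ v)
  have hU0 (e) : 0 ≤ Q.updatePlus e := (sq_nonneg _).trans (Q.update_size_le hx₀ e)
  have hsize0 (v d x) : 0 ≤ (Q.check (v, d)).posSize x :=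
    Real.sInf_nonneg (by rintro _ ⟨w, -, rfl⟩; positivity)
  have hC0 (v d) : 0 ≤ Q.checkPlus v d := (hsize0 v d x₀).trans (Q.posSize_check_le hx₀ v d)
  set A := ∑ v, π v * Q.setupPlus v with hA
  have hA0 : 0 ≤ A := Finset.sum_nonneg fun v _ => mul_nonneg (hπ0 v).le (hS0 v)
  -- The weights balance the positive witness size of every routine against its share of the flow.
  set a : V → ℝ := fun v => π v * A
  set b : E → ℝ := fun e => Q.updatePlus e * (1 / (Q.graph.res e * (δ * ε)))
  set c : V × S → ℝ := fun p => Q.checkPlus p.1 p.2 * (π p.1 / ε)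
  have hb1 (e) : 0 < 1 / (Q.graph.res e * (δ * ε)) := by have := hr e; positivity
  have hc1 (v) : 0 < π v / ε := div_pos (hπ0 v) hε0
  have ha0 (v) : 0 ≤ a v := mul_nonneg (hπ0 v).le hA0
  have hb0 (e) : 0 ≤ b e := mul_nonneg (hU0 e) (hb1 e).le
  have hc0 (p) : 0 ≤ c p := mul_nonneg (hC0 _ _) (hc1 _).le
  have hneg : ∀ (p : V × S) (y : X), ∃ w, ¬ (Q.check p).IsPositive y →
      w ∈ (Q.check p).negWitnesses y ∧ ‖w‖ ^ 2 = (Q.check p).negSize y := fun p y => by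
    by_cases h : (Q.check p).IsPositive y
    · exact ⟨0, fun h' => absurd h h'⟩
    · exact (SpanProgram.exists_negWitness h).imp fun _ hw _ => hw
  choose nw hnw using hneg
  have hnw {y} (hy : ¬ Q.HasMarked y) (v : V) := hnw (v, Q.data v y) y fun h =>
    hy ⟨v, (Q.check_correct v _ y rfl).1 h⟩
  have hu : ∀ x, Q.HasMarked x → ∃ u ∈ Q.totalAvail x, ‖u‖ ^ 2 ≤ 4 ∧
      ∀ y, ¬ Q.HasMarked y → inner ℂ u (Q.negVec a b c nw y) = 1 := by
    intro x hx
    obtain ⟨f, hf, hfe⟩ := ResistorGraph.exists_flow hc hG hπ hx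
    rw [← hδ] at hfe
    set m := ∑ v ∈ Q.marked x, π v with hm
    have hεm : ε ≤ m := hε ▸ Q.markedFraction_le π hx
    have hm0 : 0 < m := hε0.trans_le hεm
    have hex : ∀ p : V × S, ∃ w, (Q.check p).IsPositive x →
        w ∈ (Q.check p).posWitnesses x ∧ ‖w‖ ^ 2 = (Q.check p).posSize x := fun p => by
      by_cases h : (Q.check p).IsPositive x
      · exact h.exists_posWitness.imp fun _ hw _ => hw
      · exact ⟨0, fun h' => absurd h' h⟩
    choose pw hpw using hex
    have hpw (v) (hv : v ∈ Q.marked x) := hpw (v, Q.data v x)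
      ((Q.check_correct v _ x rfl).2 hv)
    have hpwC (v) (hv : v ∈ Q.marked x) :
        ‖pw (v, Q.data v x)‖ ^ 2 ≤ Q.checkPlus v (Q.data v x) :=
      (hpw v hv).2.trans_le (Q.posSize_check_le hx v _)
    refine ⟨Q.posVec a b c pw π f (fun v => π v / m) x,
      QuantumWalkSearch.posVec_mem fun v hv => (hpw v hv).1, ?_, fun y hy =>
      QuantumWalkSearch.inner_posVec_negVec (fun v hv => (hpw v hv).1) (fun v => (hnw hy v).1)
        (fun v h => ?_) (fun e h => ?_) (fun v hv h => ?_) hπ.1.2 hf⟩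
    · rw [QuantumWalkSearch.norm_sq_posVec ha0 hb0 hc0]
      have h1 : ∑ v, π v ^ 2 / a v * ‖(Q.setup v).witness true x‖ ^ 2 ≤ 1 := by
        calc _ ≤ ∑ v, π v ^ 2 / a v * Q.setupPlus v := by
              refine Finset.sum_le_sum fun v _ => ?_
              have := ha0 v
              gcongr
              exact Q.setup_size_le hx v
          _ = A / A := by
              conv_rhs => rw [hA, Finset.sum_div]
              refine Finset.sum_congr rfl fun v _ => ?_
              have := (hπ0 v).ne'
              simp only [a]
              rw [sq, mul_div_mul_left _ _ this]
              ring
          _ ≤ 1 := div_self_le_one A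
      have h2 : ∑ e, f e ^ 2 / b e * ‖(Q.update e).witness true x‖ ^ 2 ≤ 2 := by
        calc _ ≤ ∑ e, f e ^ 2 / (1 / (Q.graph.res e * (δ * ε))) :=
              Finset.sum_le_sum fun e _ =>
                sq_div_mul_mul_le (hb1 e) (Q.update_size_le hx e) (sq_nonneg _)
          _ = δ * ε * ∑ e, Q.graph.res e * f e ^ 2 := by
              rw [Finset.mul_sum]
              exact Finset.sum_congr rfl fun e _ => by rw [div_div_eq_mul_div]; ring
          _ ≤ δ * ε * (2 / (δ * m)) := by gcongr
          _ = 2 * (ε / m) := by field_simp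
          _ ≤ 2 := by linarith [(div_le_one hm0).2 hεm]
      have h3 : ∑ v ∈ Q.marked x, (π v / m) ^ 2 / c (v, Q.data v x) * ‖pw (v, Q.data v x)‖ ^ 2
          ≤ 1 := by
        calc _ ≤ ∑ v ∈ Q.marked x, (π v / m) ^ 2 / (π v / ε) :=
              Finset.sum_le_sum fun v hv =>
                sq_div_mul_mul_le (hc1 v) (hpwC v hv) (sq_nonneg _)
          _ = ∑ v ∈ Q.marked x, π v * (ε / m ^ 2) := by
              refine Finset.sum_congr rfl fun v _ => ?_
              have := (hπ0 v).ne'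
              field_simp
          _ = ε / m := by rw [← Finset.sum_mul, ← hm]; field_simp
          _ ≤ 1 := (div_le_one hm0).2 hεm
      linarith
    -- A routine has weight `0` only if its chosen witnesses on positive inputs vanish.
    · have h0 : A = 0 := by
        have := (Real.sqrt_eq_zero (ha0 v)).1 h
        simpa [a, (hπ0 v).ne'] using this
      have h1 := (Finset.sum_eq_zero_iff_of_nonneg fun v _ =>
        mul_nonneg (hπ0 v).le (hS0 v)).1 (hA ▸ h0) v (Finset.mem_univ v)
      have h2 := Q.setup_size_le hx v
      rw [(mul_eq_zero_iff_left (hπ0 v).ne').1 h1] at h2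
      simpa using le_antisymm h2 (sq_nonneg _)
    · have h0 := (Real.sqrt_eq_zero (hb0 e)).1 h
      have h2 := Q.update_size_le hx e
      rw [(mul_eq_zero_iff_right (hb1 e).ne').1 h0] at h2
      simpa using le_antisymm h2 (sq_nonneg _)
    · have h0 := (Real.sqrt_eq_zero (hc0 _)).1 h
      have h2 := hpwC v hv
      rw [(mul_eq_zero_iff_right (hc1 v).ne').1 h0] at h2
      simpa using le_antisymm h2 (sq_nonneg _)
  obtain ⟨P, hP, hcomp, hPpos, hPneg⟩ := SpanProgram.exists_of_witnesses
    (fun x => Q.totalAvail x) Q.HasMarked (Q.negVec a b c nw) 4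
    (fun y hy => Q.negVec_mem_orthogonal fun v => (hnw hy v).1) hu ⟨x₀, hx₀⟩
  refine ⟨P, hP, hcomp, hPpos, fun y hy => (hPneg y hy).trans ?_⟩
  rw [QuantumWalkSearch.norm_sq_negVec ha0 hb0 hc0]
  have h1 : ∑ v, a v * (Q.setup v).size false y = A * ∑ v, π v * (Q.setup v).size false y := by
    rw [Finset.mul_sum]
    exact Finset.sum_congr rfl fun v _ => by ring
  have h2 : ∑ e, b e * (Q.update e).size false y ≤ 1 / ε * (1 / δ *
      Q.graph.stepExpectation π (fun e => Q.updatePlus e * (Q.update e).size false y)) := by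
    calc _ = 1 / ε * (1 / δ *
          ∑ e, Q.updatePlus e * (Q.update e).size false y / Q.graph.res e) := by
          rw [Finset.mul_sum, Finset.mul_sum]
          refine Finset.sum_congr rfl fun e _ => ?_
          simp only [b]
          have := (hr e).ne'
          field_simp
      _ ≤ _ := by
          gcongr
          exact ResistorGraph.sum_div_res_le_stepExpectation hc hG hπ
            fun e => mul_nonneg (hU0 e) (sq_nonneg _)
  have h3 : ∑ v, c (v, Q.data v y) * ‖nw (v, Q.data v y) y‖ ^ 2 =
      1 / ε * ∑ v, π v * (Q.checkPlus v (Q.data v y) *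
        (Q.check (v, Q.data v y)).negSize y) := by
    rw [Finset.mul_sum]
    refine Finset.sum_congr rfl fun v _ => ?_
    rw [(hnw hy v).2]
    simp only [c]
    ring
  have h1' : 0 ≤ ∑ v, a v * (Q.setup v).size false y :=
    Finset.sum_nonneg fun v _ => mul_nonneg (ha0 v) (sq_nonneg _)
  have h2' : 0 ≤ ∑ e, b e * (Q.update e).size false y :=
    Finset.sum_nonneg fun e _ => mul_nonneg (hb0 e) (sq_nonneg _)
  have h3' : 0 ≤ ∑ v, c (v, Q.data v y) * ‖nw (v, Q.data v y) y‖ ^ 2 :=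
    Finset.sum_nonneg fun v _ => mul_nonneg (hc0 _) (sq_nonneg _)
  rw [h1] at h1' ⊢
  rw [h3] at h3' ⊢
  rw [mul_add (1 / ε)]
  linarith
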